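/- Let $p$ be a prime, let $k$ be a field of characteristic $p$, and let $G$ be a finite group scheme over $k$, that is, an affine group scheme whose coordinate algebra $k[G]$ is a finite dimensional commutative Hopf algebra over $k$. Its group algebra $kG$ is the linear dual $\operatorname{Hom}_k(k[G],k)$ with the product dual to the coproduct of $k[G]$, and $G$-modules are left $kG$-modules. For a field extension $K/k$ write $G_K$ for the group scheme over $K$ with coordinate algebra $K\otimes_k k[G]$, and $KG\cong K\otimes_k kG$ for its group algebra. A $\pi$-point of $G$ defined over $K$ is a homomorphism of $K$-algebras $\alpha\colon K[t]/(t^p)\to KG$ which factors through the group algebra of a unipotent abelian (closed) subgroup scheme of $G_K$ and along which $KG$ is flat as a left $K[t]/(t^p)$-module. Let $K$ be regarded as a $K[t]/(t^p)$-module with $t$ acting as zero. The point module of $\alpha$ is $$\Delta_G(\alpha):=\operatorname{res}^K_k\bigl(KG\otimes_{K[t]/(t^p)}K\bigr),$$ where $KG$ is a right $K[t]/(t^p)$-module via $\alpha$ and $\operatorname{res}^K_k$ is restriction of modules along the canonical map $kG\to KG$. For a ring $R$ and an $R$-module $M$, call $M$ endofinite if it has finite composition length as a module over $\operatorname{End}_R(M)$.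 Let $\operatorname{Add}(M)$ (respectively $\operatorname{Prod}(M)$) be the full subcategory of all $R$-modules isomorphic to a direct summand of a direct sum (respectively a product) of copies of $M$, indexed by an arbitrary set. Proposition 3.6. For every field extension $K/k$ and every $\pi$-point $\alpha\colon K[t]/(t^p)\to KG$ of $G$, the $G$-module $\Delta_G(\alpha)$ is endofinite, and $$\operatorname{Add}(\Delta_G(\alpha))=\operatorname{Prod}(\Delta_G(\alpha)).$$ -/

import Mathlib

open scoped TensorProduct Polynomial

universe u v w x y

noncomputable section

namespace FiniteGroupScheme

/-! ### Group algebras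

A finite group scheme `G` over a field `k` is given by its coordinate algebra `A = k[G]`, a
commutative Hopf algebra over `k` that is finite dimensional as a vector space. -/

/-- The group algebra `kG`: the linear dual of the coordinate algebra `A = k[G]`, whose product is
the convolution `(f * g)(a) = ∑ f(a₁) g(a₂)` and whose unit is the counit of `A`. -/
abbrev GroupAlgebra (k : Type u) (A : Type v) [Field k] [CommRing A] [HopfAlgebra k A] :
    Type (max u v) :=
  WithConv (A →ₗ[k] k)

/-- The map of group algebras `kH → kG` attached to a homomorphism of group schemes `H → G`, which
is a bialgebra homomorphism `φ : k[G] → k[H]`; it sends `f` to `f ∘ φ`. -/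
def GroupAlgebra.map {k : Type u} {A : Type v} {B : Type w} [Field k]
    [CommRing A] [HopfAlgebra k A] [CommRing B] [HopfAlgebra k B] (φ : A →ₐc[k] B) :
    GroupAlgebra k B →ₐ[k] GroupAlgebra k A :=
  AlgHom.ofLinearMap
    { toFun := fun f => WithConv.toConv (f.ofConv ∘ₗ φ.toCoalgHom.toLinearMap)
      map_add' := fun _ _ => rfl
      map_smul' := fun _ _ => rfl }
    (by ext a; simp)
    (fun f g => WithConv.ext
      (LinearMap.convMul_comp_coalgHom_distrib (f := f) (g := g) (h := φ.toCoalgHom)))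

/-- `G` is unipotent: every nonzero `G`-module has a nonzero fixed vector, that is, a nonzero vector
on which `kG` acts through the augmentation `f ↦ f 1`.  It is enough to ask this of the modules in
the universe of `kG`, as each nonzero module contains a nonzero quotient of `kG`. -/
def IsUnipotent (k : Type u) (A : Type v) [Field k] [CommRing A] [HopfAlgebra k A] : Prop :=
  ∀ (M : Type (max u v)) [AddCommGroup M] [Module (GroupAlgebra k A) M] [Nontrivial M],
    ∃ m : M, m ≠ 0 ∧ ∀ f : GroupAlgebra k A,
      f • m = algebraMap k (GroupAlgebra k A) (f.ofConv 1) • m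

/-- The coordinate algebra `K[G] = K ⊗ k[G]` of the group scheme `G_K` obtained by extending the
base field. -/
abbrev BaseChange (k : Type u) (A : Type v) (K : Type w) [Field k] [CommRing A] [HopfAlgebra k A]
    [Field K] [Algebra k K] : Type (max v w) :=
  K ⊗[k] A

/-- The canonical map `kG → KG`, sending `f` to its `K`-linear extension `c ⊗ a ↦ c f(a)`.  It
induces the natural isomorphism `K ⊗ kG ≅ KG`. -/
def GroupAlgebra.extend (k : Type u) (A : Type v) (K : Type w) [Field k] [CommRing A]
    [HopfAlgebra k A] [Field K] [Algebra k K] :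
    GroupAlgebra k A →ₐ[k] GroupAlgebra K (BaseChange k A K) :=
  AlgHom.ofLinearMap
    { toFun := fun f => WithConv.toConv
        ((TensorProduct.AlgebraTensorModule.rid k K K).toLinearMap ∘ₗ f.ofConv.baseChange K)
      map_add' := fun f g => by
        ext a
        simp
      map_smul' := fun c f => by
        ext a
        change (c • f.ofConv a) • (1 : K) = c • (f.ofConv a • (1 : K))
        exact smul_assoc c (f.ofConv a) (1 : K) }
    (by
      ext a
      simp [Algebra.smul_def])
    (fun f g => by
      ext a
      simp only [TensorProduct.AlgebraTensorModule.curry_apply, TensorProduct.curry_apply, LinearMap.coe_mk, AddHom.coe_mk, LinearMap.convMul_apply,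
        LinearMap.coe_restrictScalars, LinearMap.comp_apply, LinearEquiv.coe_coe,
        LinearMap.baseChange_tmul, TensorProduct.AlgebraTensorModule.rid_tmul,
        TensorProduct.comul_tmul, CommSemiring.comul_apply]
      generalize (CoalgebraStruct.comul a : A ⊗[k] A) = z
      induction z with
      | zero => simp
      | add z₁ z₂ h₁ h₂ => simp only [map_add, TensorProduct.tmul_add, add_smul, h₁, h₂]
      | tmul b c => simp [Algebra.smul_def])

/-! ### `π`-points -/

/-- The algebra `K[t]/(t^p)`. -/
abbrev TruncatedPolynomial (p : ℕ) (K : Type w) [Field K] : Type w :=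
  AdjoinRoot (Polynomial.X ^ p : K[X])

/-- A `π`-point of `G` defined over the field extension `K` of `k`: a morphism of `K`-algebras
`K[t]/(t^p) → KG` that factors through the group algebra of a unipotent abelian subgroup scheme `U`
of `G_K`, and such that `KG` is flat as a left module over `K[t]/(t^p)`.  The subgroup scheme `U` is
given by the Hopf ideal `I` of `K[G]` that defines it, so that `K[U] = K[G] / I`; it is abelian when
`K[U]` is cocommutative. -/
structure PiPoint (p : ℕ) (k : Type u) (A : Type v) (K : Type w) [Field k] [CommRing A]
    [HopfAlgebra k A] [Field K] [Algebra k K] where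
  /-- The underlying morphism of `K`-algebras. -/
  toAlgHom : TruncatedPolynomial p K →ₐ[K] GroupAlgebra K (BaseChange k A K)
  factors : ∃ (I : Ideal (BaseChange k A K)) (_ : I.IsHopfIdeal K),
    Coalgebra.IsCocomm K (BaseChange k A K ⧸ I) ∧ IsUnipotent K (BaseChange k A K ⧸ I) ∧
    ∃ β : TruncatedPolynomial p K →ₐ[K] GroupAlgebra K (BaseChange k A K ⧸ I),
      toAlgHom = (GroupAlgebra.map (Bialgebra.Quotient.mkBialgHom I)).comp β
  flat : letI : Module (TruncatedPolynomial p K) (GroupAlgebra K (BaseChange k A K)) :=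
      Module.compHom _ toAlgHom.toRingHom
    Module.Flat (TruncatedPolynomial p K) (GroupAlgebra K (BaseChange k A K))

/-! ### Point modules -/

/-- For a ring homomorphism `α : R → B` with `R` commutative, the ring `B` as a `B`-`R`-bimodule,
where `R` acts from the right through `α`. -/
def RightRestriction {R : Type u} {B : Type v} [CommRing R] [Ring B] (_ : R →+* B) : Type v := B

section RightRestriction

variable {R : Type u} {B : Type v} [CommRing R] [Ring B] (α : R →+* B)

instance : AddCommGroup (RightRestriction α) := inferInstanceAs (AddCommGroup B)

/-- The left action of `B` on itself. -/
instance : Module B (RightRestriction α) := inferInstanceAs (Module B B)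

/-- The action of `R` by right multiplication through `α`. -/
instance : Module R (RightRestriction α) where
  smul r b := (show B from b) * α r
  one_smul b := show (show B from b) * α 1 = b by rw [map_one, mul_one]
  mul_smul r s b := show (show B from b) * α (r * s) = (show B from b) * α s * α r by
    rw [mul_comm, map_mul, mul_assoc]
  smul_zero r := zero_mul (α r)
  smul_add r b c := add_mul (show B from b) (show B from c) (α r)
  add_smul r s b := show (show B from b) * α (r + s) = _ by rw [map_add, mul_add]; rfl
  zero_smul b := show (show B from b) * α 0 = 0 by rw [map_zero, mul_zero]

instance : SMulCommClass R B (RightRestriction α) where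
  smul_comm r b c := mul_assoc b (show B from c) (α r)

end RightRestriction

/-- The left adjoint `α_* M = B ⊗_R M` of the restriction along `α : R → B`. -/
abbrev Induced {R : Type u} {B : Type v} [CommRing R] [Ring B] (α : R →+* B) (M : Type w)
    [AddCommGroup M] [Module R M] : Type (max v w) :=
  RightRestriction α ⊗[R] M

/-- The augmentation `K[t]/(t^p) → K`, sending `t` to `0`. -/
def augmentation (p : ℕ) [Fact p.Prime] (K : Type w) [Field K] :
    TruncatedPolynomial p K →+* K :=
  AdjoinRoot.lift (RingHom.id K) 0 (by simp [(Fact.out : p.Prime).ne_zero])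

/-- The field `K` as a module over `K[t]/(t^p)`, with `t` acting as zero. -/
def TrivialModule (_p : ℕ) (K : Type w) : Type w := K

section TrivialModule

variable (p : ℕ) [Fact p.Prime] (K : Type w) [Field K]

instance : AddCommGroup (TrivialModule p K) := inferInstanceAs (AddCommGroup K)

instance : Module (TruncatedPolynomial p K) (TrivialModule p K) :=
  (Module.compHom K (augmentation p K) : Module (TruncatedPolynomial p K) K)

end TrivialModule

section PointModule

variable {p : ℕ} [Fact p.Prime] {k : Type u} {A : Type v} {K : Type w} [Field k] [CommRing A]
  [HopfAlgebra k A] [Field K] [Algebra k K] (α : PiPoint p k A K)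

/-- The point module `Δ_G(α) = res α_*(K)`, where `res` is the restriction of `KG`-modules along
`kG → KG`. -/
def PointModule : Type (max v w) :=
  Induced α.toAlgHom.toRingHom (TrivialModule p K)

instance : AddCommGroup (PointModule α) :=
  inferInstanceAs (AddCommGroup (Induced α.toAlgHom.toRingHom (TrivialModule p K)))

/-- The action of `KG` on `α_*(K)`. -/
instance : Module (GroupAlgebra K (BaseChange k A K)) (PointModule α) :=
  inferInstanceAs (Module (GroupAlgebra K (BaseChange k A K))
    (Induced α.toAlgHom.toRingHom (TrivialModule p K)))

/-- The structure of `G`-module on the point module, by restriction along `kG → KG`. -/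
instance : Module (GroupAlgebra k A) (PointModule α) :=
  Module.compHom _ (GroupAlgebra.extend k A K).toRingHom

end PointModule

/-! ### Endofinite modules and the subcategories `Add` and `Prod` -/

section Endofinite

variable (R : Type u) [Ring R] (M : Type v) [AddCommGroup M] [Module R M]

/-- `M` is endofinite: it has finite length as a module over its endomorphism ring. -/
def IsEndofinite : Prop := IsFiniteLength (Module.End R M) M

/-- `N` is isomorphic to a direct summand of `X`. -/
def IsSummand (N : Type w) [AddCommGroup N] [Module R N] (X : Type x) [AddCommGroup X]
    [Module R X] : Prop :=
  ∃ P Q : Submodule R X, IsCompl P Q ∧ Nonempty (N ≃ₗ[R] P)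

/-- `Add(M)`: the full subcategory of direct summands of direct sums of copies of `M`. -/
def AddCat : CategoryTheory.ObjectProperty (ModuleCat.{y} R) :=
  fun N => ∃ ι : Type y, IsSummand R N (ι →₀ M)

/-- `Prod(M)`: the full subcategory of direct summands of products of copies of `M`. -/
def ProdCat : CategoryTheory.ObjectProperty (ModuleCat.{y} R) :=
  fun N => ∃ ι : Type y, IsSummand R N (ι → M)

end Endofinite

end FiniteGroupScheme

end

/-!
The group algebra `KG` is finite dimensional over `K`, since `k[G]` is finite dimensional over `k`,
and the point module `M` is a cyclic `KG`-module; so `M` is finite dimensional over `K`. The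
scalars in `K` are central in `KG`, so they commute with the action of `kG` on `M`. The rest holds
for every ring `R` and every `R`-module `M` that is finite dimensional over a field `K` whose
action commutes with that of `R`.

The module `M` is endofinite, because `K` acts through `End_R(M)` and therefore every
`End_R(M)`-submodule is a `K`-subspace, so that chains of such submodules have bounded length.
For an
arbitrary set `ι`, finite dimensionality of `M` gives isomorphisms of `R`-modules
`M^ι ≅ M ⊗_K K^ι` (`tensorPiEquiv`) and `M^(ι) ≅ M ⊗_K K^(ι)` (`tensorFinsuppEquiv`). The functor
`M ⊗_K -` carries facts about vector spaces to facts about `R`-modules: `K^ι` has a basis, so a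
product of copies of `M` is a direct sum of copies of `M` (`IsSummand.finsupp_of_pi`); and `K^(ι)`
has a complement in `K^ι`, so a direct sum of copies of `M` is a direct summand of a product of
copies of `M` (`IsSummand.pi_of_finsupp`).
-/

noncomputable section

namespace FiniteGroupScheme

/-! ### Direct summands -/

section Summand

variable {R : Type u} [Ring R] {N : Type v} [AddCommGroup N] [Module R N]
  {X : Type w} [AddCommGroup X] [Module R X] {Y : Type x} [AddCommGroup Y] [Module R Y]

theorem isSummand_iff_exists_leftInverse :
    IsSummand R N X ↔ ∃ (i : N →ₗ[R] X) (r : X →ₗ[R] N), Function.LeftInverse r i := by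
  constructor
  · rintro ⟨P, Q, h, ⟨e⟩⟩
    refine ⟨P.subtype ∘ₗ e.toLinearMap, e.symm.toLinearMap ∘ₗ P.projectionOnto Q h, fun n => ?_⟩
    simp
  · rintro ⟨i, r, h⟩
    let e : N ≃ₗ[R] LinearMap.range i := LinearEquiv.ofInjective i h.injective
    refine ⟨LinearMap.range i, LinearMap.ker (e.toLinearMap ∘ₗ r),
      LinearMap.isCompl_of_proj ?_, ⟨e⟩⟩
    rintro ⟨_, n, rfl⟩
    exact Subtype.ext (congrArg i (h n))

theorem IsSummand.of_leftInverse (h : IsSummand R N X) (i : X →ₗ[R] Y) (r : Y →ₗ[R] X)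
    (hri : Function.LeftInverse r i) : IsSummand R N Y := by
  obtain ⟨j, s, hsj⟩ := isSummand_iff_exists_leftInverse.mp h
  exact isSummand_iff_exists_leftInverse.mpr
    ⟨i ∘ₗ j, s ∘ₗ r, fun n => (congrArg s (hri (j n))).trans (hsj n)⟩

end Summand

/-! ### Modules that are finite dimensional over a commuting field -/

section FiniteDimensional

variable {R : Type u} [Ring R] (M : Type v) [AddCommGroup M] [Module R M]
  {K : Type w} [Field K] [Module K M] [SMulCommClass K R M]

/-- The scalars in `K` act by `R`-linear endomorphisms, so that every `End_R(M)`-submodule of `M`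
is a `K`-subspace. -/
theorem isEndofinite_of_finiteDimensional [Module.Finite K M] : IsEndofinite R M :=
  have : SMulCommClass R K M := SMulCommClass.symm K R M
  have : IsScalarTower K (Module.End R M) M := ⟨fun _ _ _ => rfl⟩
  isFiniteLength_iff_isNoetherian_isArtinian.mpr
    ⟨isNoetherian_of_tower K inferInstance, isArtinian_of_tower K inferInstance⟩

/-- The map `M ⊗ V → M ⊗ W` induced by a `K`-linear map `V → W`, as a map of `R`-modules. -/
def tensorMap {V : Type x} [AddCommGroup V] [Module K V] {W : Type y} [AddCommGroup W]
    [Module K W] (f : V →ₗ[K] W) : M ⊗[K] V →ₗ[R] M ⊗[K] W where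
  toFun := f.lTensor M
  map_add' := map_add _
  map_smul' r t := by
    induction t with
    | zero => simp
    | add s t hs ht => simp only [smul_add, map_add, hs, ht]
    | tmul m v => simp [TensorProduct.smul_tmul']

theorem tensorMap_leftInverse {V : Type x} [AddCommGroup V] [Module K V] {W : Type y}
    [AddCommGroup W] [Module K W] {f : V →ₗ[K] W} {g : W →ₗ[K] V} (h : g ∘ₗ f = LinearMap.id) :
    Function.LeftInverse (tensorMap (R := R) M g) (tensorMap (R := R) M f) := fun t => by
  change g.lTensor M (f.lTensor M t) = t
  rw [← LinearMap.lTensor_comp_apply, h, LinearMap.lTensor_id_apply]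

open scoped Classical in
/-- The isomorphism of `R`-modules `M ⊗ K^(ι) ≃ M^(ι)`. -/
def tensorFinsuppEquiv (ι : Type x) : M ⊗[K] (ι →₀ K) ≃ₗ[R] (ι →₀ M) :=
  { (TensorProduct.finsuppScalarRight K K M ι).toAddEquiv with
    map_smul' := fun r t => by
      change TensorProduct.finsuppScalarRight K K M ι (r • t) =
        r • TensorProduct.finsuppScalarRight K K M ι t
      induction t with
      | zero => simp
      | add s t hs ht => simp only [smul_add, map_add, hs, ht]
      | tmul m v =>
        ext i
        simp [TensorProduct.smul_tmul', smul_comm] }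

variable (K) in
/-- The natural map `M ⊗ K^ι → M^ι` is bijective for every set `ι`, as `M` is finite dimensional:
for a basis `b` of `M` the inverse sends a family to the sum over `j` of the tensors of `b j` with
the family of its `j`-th coordinates. -/
theorem piScalarRightHom_bijective [Module.Finite K M] (ι : Type x) :
    Function.Bijective (TensorProduct.piScalarRightHom K K M ι) := by
  let b := Module.finBasis K M
  let inv : (ι → M) →ₗ[K] M ⊗[K] (ι → K) :=
    ∑ j, TensorProduct.mk K M (ι → K) (b j) ∘ₗ (b.coord j).compLeft ι
  have inv_apply (f : ι → M) : inv f = ∑ j, b j ⊗ₜ[K] fun i => b.repr (f i) j := by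
    simp only [inv, LinearMap.sum_apply]
    rfl
  refine Function.bijective_iff_has_inverse.mpr ⟨inv, fun t => ?_, fun f => ?_⟩
  · induction t with
    | zero => simp
    | add s t hs ht => simp only [map_add, hs, ht]
    | tmul m v =>
      have hj (j) : (fun i => b.repr (v i • m) j) = b.repr m j • v := by
        ext i
        simp [mul_comm]
      rw [inv_apply]
      simp only [TensorProduct.piScalarRightHom_tmul, hj, ← TensorProduct.smul_tmul,
        ← TensorProduct.sum_tmul, b.sum_repr]
  · ext i
    simp only [inv_apply, map_sum, Finset.sum_apply, TensorProduct.piScalarRightHom_tmul,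
      b.sum_repr]

/-- The isomorphism of `R`-modules `M ⊗ K^ι ≃ M^ι` for a finite dimensional `M` and an arbitrary
set `ι`. -/
def tensorPiEquiv [Module.Finite K M] (ι : Type x) : M ⊗[K] (ι → K) ≃ₗ[R] (ι → M) :=
  LinearEquiv.ofBijective
    { toFun := TensorProduct.piScalarRightHom K K M ι
      map_add' := map_add _
      map_smul' := fun r t => by
        induction t with
        | zero => simp
        | add s t hs ht => simp only [smul_add, map_add, hs, ht]
        | tmul m v =>
          ext i
          simp [TensorProduct.smul_tmul', smul_comm] }
    (piScalarRightHom_bijective M K ι)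

variable {M}

variable (K) in
theorem IsSummand.pi_of_finsupp [Module.Finite K M] {N : Type y} [AddCommGroup N] [Module R N]
    {ι : Type x} (h : IsSummand R N (ι →₀ M)) : IsSummand R N (ι → M) := by
  obtain ⟨g, hg⟩ := (Finsupp.lcoeFun : (ι →₀ K) →ₗ[K] (ι → K)).exists_leftInverse_of_injective
    (LinearMap.ker_eq_bot.mpr DFunLike.coe_injective)
  refine h.of_leftInverse
    ((tensorPiEquiv M ι).toLinearMap ∘ₗ tensorMap M Finsupp.lcoeFun ∘ₗ
      (tensorFinsuppEquiv (R := R) (K := K) M ι).symm.toLinearMap)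
    ((tensorFinsuppEquiv M ι).toLinearMap ∘ₗ tensorMap M g ∘ₗ
      (tensorPiEquiv (R := R) (K := K) M ι).symm.toLinearMap) fun f => ?_
  simp [tensorMap_leftInverse M hg _]

variable (K) in
/-- A product of copies of `M` is a direct sum of copies of `M`, indexed by a basis of the vector
space `K^ι`. -/
theorem IsSummand.finsupp_of_pi [Module.Finite K M] {N : Type y} [AddCommGroup N] [Module R N]
    {ι : Type x} (h : IsSummand R N (ι → M)) :
    IsSummand R N (Module.Basis.ofVectorSpaceIndex K (ι → K) →₀ M) := by
  let e := (Module.Basis.ofVectorSpace K (ι → K)).repr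
  refine h.of_leftInverse
    ((tensorFinsuppEquiv M _).toLinearMap ∘ₗ tensorMap M e.toLinearMap ∘ₗ
      (tensorPiEquiv (R := R) (K := K) M ι).symm.toLinearMap)
    ((tensorPiEquiv M ι).toLinearMap ∘ₗ tensorMap M e.symm.toLinearMap ∘ₗ
      (tensorFinsuppEquiv (R := R) (K := K) M _).symm.toLinearMap) fun f => ?_
  simp [tensorMap_leftInverse M (f := e.toLinearMap) (g := e.symm.toLinearMap) (by ext; simp) _]

variable (R M K) in
/-- The index sets lie in a universe that contains `K`, so that it contains a basis of `K^ι`. -/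
theorem addCat_eq_prodCat_of_finiteDimensional [Module.Finite K M] :
    AddCat.{u, v, max w x} R M = ProdCat.{u, v, max w x} R M := by
  ext N
  constructor
  · rintro ⟨ι, h⟩
    exact ⟨ι, h.pi_of_finsupp K⟩
  · rintro ⟨ι, h⟩
    exact ⟨_, h.finsupp_of_pi K⟩

end FiniteDimensional

/-! ### The scalars of the point module -/

section PointModule

variable {p : ℕ} [Fact p.Prime] {k : Type u} {A : Type v} {K : Type w} [Field k] [CommRing A]
  [HopfAlgebra k A] [Field K] [Algebra k K] (α : PiPoint p k A K)

/-- The field `K` acts on the point module through the centre of `KG`. -/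
instance PointModule.instModuleField : Module K (PointModule α) :=
  Module.compHom _ (algebraMap K (GroupAlgebra K (BaseChange k A K)))

instance : IsScalarTower K (GroupAlgebra K (BaseChange k A K)) (PointModule α) where
  smul_assoc c b m := by
    rw [Algebra.smul_def, mul_smul]
    rfl

instance : SMulCommClass K (GroupAlgebra k A) (PointModule α) where
  smul_comm c f m := by
    symm
    change GroupAlgebra.extend k A K f •
        algebraMap K (GroupAlgebra K (BaseChange k A K)) c • m =
      algebraMap K (GroupAlgebra K (BaseChange k A K)) c • GroupAlgebra.extend k A K f • m
    rw [← mul_smul, ← mul_smul, Algebra.commutes]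

/-- The point module is a cyclic `KG`-module, generated by `1 ⊗ 1`. -/
theorem PointModule.exists_smul_eq :
    ∃ e : PointModule α, ∀ m : PointModule α, ∃ b : GroupAlgebra K (BaseChange k A K),
      b • e = m := by
  let one : RightRestriction α.toAlgHom.toRingHom := (1 : GroupAlgebra K (BaseChange k A K))
  let unit : TrivialModule p K := (1 : K)
  refine ⟨one ⊗ₜ[TruncatedPolynomial p K] unit, fun m => ?_⟩
  induction m using TensorProduct.induction_on with
  | zero => exact ⟨0, zero_smul (A := PointModule α) (GroupAlgebra K (BaseChange k A K)) _⟩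
  | add m n hm hn =>
    obtain ⟨b, rfl⟩ := hm
    obtain ⟨c, rfl⟩ := hn
    exact ⟨b + c, add_smul b c _⟩
  | tmul b c =>
    let r : TruncatedPolynomial p K := AdjoinRoot.of _ (show K from c)
    have hr : r • unit = c := by
      change augmentation p K (AdjoinRoot.of _ (show K from c)) * (1 : K) = c
      rw [augmentation, AdjoinRoot.lift_of, mul_one]
      rfl
    refine ⟨(show GroupAlgebra K (BaseChange k A K) from b) * α.toAlgHom r, ?_⟩
    have hb : ((show GroupAlgebra K (BaseChange k A K) from b) * α.toAlgHom r) • one = r • b :=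
      mul_one ((show GroupAlgebra K (BaseChange k A K) from b) * α.toAlgHom r)
    calc _ = (((show GroupAlgebra K (BaseChange k A K) from b) * α.toAlgHom r) • one)
            ⊗ₜ[TruncatedPolynomial p K] unit := rfl
      _ = b ⊗ₜ[TruncatedPolynomial p K] c := by rw [hb, TensorProduct.smul_tmul, hr]

instance [Module.Finite k A] : Module.Finite K (PointModule α) := by
  have : Module.Finite K (GroupAlgebra K (BaseChange k A K)) :=
    Module.Finite.equiv (WithConv.linearEquiv K (BaseChange k A K →ₗ[K] K)).symm
  obtain ⟨e, he⟩ := PointModule.exists_smul_eq α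
  exact Module.Finite.of_surjective
    ((LinearMap.toSpanSingleton (GroupAlgebra K (BaseChange k A K)) _ e).restrictScalars K) he

end PointModule

end FiniteGroupScheme

end

theorem proposition3p6 (p : ℕ) [Fact p.Prime]
    (k : Type u) [Field k] [CharP k p]
    (A : Type v) [CommRing A] [HopfAlgebra k A] [Module.Finite k A]
    (K : Type w) [Field K] [Algebra k K]
    (α : FiniteGroupScheme.PiPoint p k A K) :
    FiniteGroupScheme.IsEndofinite (FiniteGroupScheme.GroupAlgebra k A)
        (FiniteGroupScheme.PointModule α) ∧
      FiniteGroupScheme.AddCat.{max u v, max v w, max u v w}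
          (FiniteGroupScheme.GroupAlgebra k A) (FiniteGroupScheme.PointModule α) =
        FiniteGroupScheme.ProdCat.{max u v, max v w, max u v w}
          (FiniteGroupScheme.GroupAlgebra k A) (FiniteGroupScheme.PointModule α) :=
  ⟨FiniteGroupScheme.isEndofinite_of_finiteDimensional (K := K) _,
    FiniteGroupScheme.addCat_eq_prodCat_of_finiteDimensional.{max u v, max v w, w, max u v}
      (FiniteGroupScheme.GroupAlgebra k A) (FiniteGroupScheme.PointModule α) K⟩
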